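/- Let $k\ge 1$ and let $f\in\mathrm{Aut}(\mathbb{C}^k)$ be a polynomial automorphism of $\mathbb{C}^k$, i.e. an element of the group (under composition) of the bijective maps $\mathbb{C}^k\to\mathbb{C}^k$ that are polynomial together with their inverse. For $g=(g_0,\dots,g_{k-1})\in\mathrm{Aut}(\mathbb{C}^k)$ let $\deg g=\max_i\deg g_i$, where $\deg g_i$ is the total degree of the polynomial $g_i$; $g^n$ denotes the $n$-th iterate, and $f^{-n}=(f^{-1})^n$. A sequence $(u_n)$ of non-negative integers is said to grow exponentially if there are real numbers $a,b>1$ and $c,C>0$ such that $c\,a^n\le u_n\le C\,b^n$ for all large $n$; and $u_n\simeq n^p$ means that there are constants $c,C>0$ with $c\,n^p\le u_n\le C\,n^p$ for all large $n$. Then: 1. The sequence $(\deg f^n)_{n\in\mathbb{N}}$ is bounded if and only if the sequence $(\deg f^{-n})_{n\in\mathbb{N}}$ is bounded. 2. The sequence $(\deg f^n)_{n\in\mathbb{N}}$ grows exponentially if and only if $(\deg f^{-n})_{n\in\mathbb{N}}$ grows exponentially. 3. If $\deg f^n\simeq n^p$ and $\deg f^{-n}\simeq n^q$ for some integers $p,q\ge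 1$, then $$\left\lfloor\frac{q+1}{k}\right\rfloor\le p\le kq .$$ -/

import Mathlib

open Filter Asymptotics

/-- A self-map of `ℂ^k` is polynomial if each of its components is given by a polynomial. -/
def IsPolynomialMap {k : ℕ} (f : (Fin k → ℂ) → (Fin k → ℂ)) : Prop :=
  ∃ P : Fin k → MvPolynomial (Fin k) ℂ, ∀ z i, MvPolynomial.eval z (P i) = f z i

theorem IsPolynomialMap.id {k : ℕ} :
    IsPolynomialMap (fun z : Fin k → ℂ => z) :=
  ⟨fun i => MvPolynomial.X i, fun z i => by simp⟩

theorem IsPolynomialMap.comp {k : ℕ} {f g : (Fin k → ℂ) → (Fin k → ℂ)}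
    (hf : IsPolynomialMap f) (hg : IsPolynomialMap g) :
    IsPolynomialMap (fun z => f (g z)) := by
  obtain ⟨P, hP⟩ := hf
  obtain ⟨Q, hQ⟩ := hg
  refine ⟨fun i => MvPolynomial.bind₁ Q (P i), fun z i => ?_⟩
  have h : (fun j => MvPolynomial.eval z (Q j)) = g z := funext (hQ z)
  change MvPolynomial.eval z (MvPolynomial.bind₁ Q (P i)) = f (g z) i
  rw [← hP (g z) i, ← h]
  simp only [← MvPolynomial.coe_aeval_eq_eval, RingHom.coe_coe, MvPolynomial.aeval_bind₁]

/-- `Aut(ℂ^k)`: the group, under composition, of the bijections of `ℂ^k` that are polynomial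
together with their inverse. -/
def PolyAut (k : ℕ) : Subgroup (Equiv.Perm (Fin k → ℂ)) where
  carrier := {f | IsPolynomialMap (fun z => f z) ∧ IsPolynomialMap (fun z => f⁻¹ z)}
  one_mem' := ⟨IsPolynomialMap.id, IsPolynomialMap.id⟩
  mul_mem' := fun {f g} hf hg => by
    refine ⟨hf.1.comp hg.1, ?_⟩
    rw [mul_inv_rev]
    exact hg.2.comp hf.2
  inv_mem' := fun {f} hf => by
    refine ⟨hf.2, ?_⟩
    rw [inv_inv]
    exact hf.1

namespace PolyAut

/-- The component polynomials `(f_0, …, f_{k-1})` of `f`. They are unique, see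
`PolyAut.components_eq`. -/
noncomputable def components {k : ℕ} (f : PolyAut k) : Fin k → MvPolynomial (Fin k) ℂ :=
  Classical.choose f.2.1

theorem eval_components {k : ℕ} (f : PolyAut k) (z : Fin k → ℂ) (i : Fin k) :
    MvPolynomial.eval z (components f i) = (f : Equiv.Perm (Fin k → ℂ)) z i :=
  Classical.choose_spec f.2.1 z i

theorem components_eq {k : ℕ} (f : PolyAut k) (P : Fin k → MvPolynomial (Fin k) ℂ)
    (hP : ∀ z i, MvPolynomial.eval z (P i) = (f : Equiv.Perm (Fin k → ℂ)) z i) :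
    components f = P :=
  funext fun i => MvPolynomial.funext fun z => by rw [eval_components, hP]

/-- The algebraic degree `max (deg f_0, …, deg f_{k-1})`. -/
noncomputable def deg {k : ℕ} (f : PolyAut k) : ℕ :=
  Finset.univ.sup fun i => (components f i).totalDegree

end PolyAut

/-- Exponential growth: the sequence lies, for all large `n`, between constant positive multiples
of two geometric progressions of ratio greater than `1`. -/
def GrowsExponentially (u : ℕ → ℕ) : Prop :=
  ∃ a b c C : ℝ, 1 < a ∧ 1 < b ∧ 0 < c ∧ 0 < C ∧
    ∀ᶠ n : ℕ in atTop, c * a ^ n ≤ (u n : ℝ) ∧ (u n : ℝ) ≤ C * b ^ n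

/-- `u_n ≃ n^p`: there are constants `c, C > 0` with `c n^p ≤ u_n ≤ C n^p` for all large `n`. -/
def GrowsLikePow (u : ℕ → ℕ) (p : ℕ) : Prop :=
  (fun n : ℕ => (u n : ℝ)) =Θ[atTop] (fun n : ℕ => (n : ℝ) ^ p)

/-! Everything follows from one inequality, `PolyAut.deg_inv_le`: `deg f⁻¹ ≤ A * deg f ^ k` with `A`
depending only on `k`. Applied to `f ^ n` and to its inverse, it bounds each degree sequence by a
constant times the `k`-th power of the other, which transfers boundedness and exponential growth and
gives `p ≤ k * q` and `q ≤ k * p`. The inequality is a dimension count. For `F` with inverse `G`,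
there are more products of powers of the `F l` and of one `X i`, with exponents at most `D`, than
their degrees allow to be independent. Substituting `G` in a linear relation makes `G i` a root of a
nonzero polynomial whose coefficients have degree at most `k * D`; `G i` divides one of the nonzero
coefficients. -/

namespace MvPolynomial

/-- Total degree at most `N` forces every exponent to be at most `N`, so the coefficients in a box
of `(N + 1) ^ card σ` exponents determine the polynomial. -/
theorem exists_sum_smul_eq_zero {ι σ K : Type*} [Fintype ι] [Fintype σ] [Field K]
    (v : ι → MvPolynomial σ K) (N : ℕ) (hv : ∀ a, (v a).totalDegree ≤ N)
    (hcard : (N + 1) ^ Fintype.card σ < Fintype.card ι) :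
    ∃ c : ι → K, c ≠ 0 ∧ ∑ a, c a • v a = 0 := by
  classical
  let L : (ι → K) →ₗ[K] ((σ → Fin (N + 1)) → K) :=
    (LinearMap.pi fun m : σ → Fin (N + 1) =>
      lcoeff K (Finsupp.equivFunOnFinite.symm fun l => (m l : ℕ))) ∘ₗ
        Fintype.linearCombination K v
  have hL : LinearMap.ker L ≠ ⊥ := by
    refine LinearMap.ker_ne_bot_of_finrank_lt ?_
    simpa using hcard
  obtain ⟨c, hc, hc0⟩ := Submodule.exists_mem_ne_zero_of_ne_bot hL
  refine ⟨c, hc0, ?_⟩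
  have hdeg : (∑ a, c a • v a).totalDegree ≤ N :=
    totalDegree_finsetSum_le fun a _ => (totalDegree_smul_le _ _).trans (hv a)
  ext m
  rw [coeff_zero]
  by_contra hm
  have hmN : ∀ l, m l < N + 1 := fun l => Nat.lt_succ_of_le <| by
    have h := (le_totalDegree (mem_support_iff.2 hm)).trans hdeg
    exact (Finsupp.le_degree l m).trans h
  have h := congrFun (LinearMap.mem_ker.1 hc) fun l => ⟨m l, hmN l⟩
  apply hm
  have hm' : (Finsupp.equivFunOnFinite.symm fun l => m l) = m := by ext; simp
  simpa [L, Fintype.linearCombination_apply, hm', coeff_sum] using h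

end MvPolynomial

/-- The coefficient is the lowest nonzero one: after cancelling the power of the variable, `g` is a
root of a polynomial whose constant term is that coefficient. -/
theorem Polynomial.exists_coeff_ne_zero_dvd {R : Type*} [CommRing R] [IsDomain R]
    {P : Polynomial R} (hP : P ≠ 0) {g : R} (hg : g ≠ 0) (h : P.eval g = 0) :
    ∃ n, P.coeff n ≠ 0 ∧ g ∣ P.coeff n := by
  obtain ⟨Q, hQ, hQX⟩ := Polynomial.exists_eq_pow_rootMultiplicity_mul_and_not_dvd P hP 0
  rw [map_zero, sub_zero] at hQ hQX
  set m := P.rootMultiplicity 0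
  have hcoeff : P.coeff m = Q.coeff 0 := by
    rw [hQ]
    simpa using Polynomial.coeff_X_pow_mul Q m 0
  have hQg : Q.eval g = 0 := by
    rw [hQ, Polynomial.eval_mul, Polynomial.eval_pow, Polynomial.eval_X] at h
    exact (mul_eq_zero.1 h).resolve_left (pow_ne_zero _ hg)
  refine ⟨m, ?_, ?_⟩
  · rwa [hcoeff, Ne, ← Polynomial.X_dvd_iff]
  · have := Polynomial.sub_dvd_eval_sub g 0 Q
    rwa [sub_zero, hQg, zero_sub, dvd_neg, ← Polynomial.coeff_zero_eq_eval_zero,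
      ← hcoeff] at this

namespace MvPolynomial

theorem totalDegree_prod_pow_le {σ R : Type*} [Fintype σ] [CommSemiring R]
    (F : σ → MvPolynomial σ R) (d D : ℕ) (hF : ∀ l, (F l).totalDegree ≤ d)
    (α : σ → ℕ) (hα : ∀ l, α l ≤ D) :
    (∏ l, F l ^ α l).totalDegree ≤ Fintype.card σ * (D * d) := by
  refine (totalDegree_finsetProd _ _).trans ?_
  refine (Finset.sum_le_card_nsmul _ _ (D * d) fun l _ => ?_).trans (by simp)
  exact (totalDegree_pow _ _).trans (Nat.mul_le_mul (hα l) (hF l))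

/-- The degree of the inverse of a polynomial map is bounded in terms of the degree of the map. -/
theorem totalDegree_le_of_bind₁_eq_X {σ K : Type*} [Fintype σ] [Field K]
    (F G : σ → MvPolynomial σ K) (hFG : ∀ i, bind₁ G (F i) = X i) (d : ℕ)
    (hF : ∀ i, (F i).totalDegree ≤ d) (i : σ) :
    (G i).totalDegree ≤ Fintype.card σ * (Fintype.card σ * d + 1) ^ Fintype.card σ := by
  classical
  set k := Fintype.card σ with hk
  -- With this `D` the box of exponents has at most `D * (D + 1) ^ k` points, fewer than the `(D +
  -- 1) ^ (k + 1)` products.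
  set D := (k * d + 1) ^ k with hD
  by_cases hGi : G i = 0
  · simp [hGi]
  let v : Fin (D + 1) × (σ → Fin (D + 1)) → MvPolynomial σ K :=
    fun a => (∏ l, F l ^ (a.2 l : ℕ)) * X i ^ (a.1 : ℕ)
  obtain ⟨c, hc0, hc⟩ := exists_sum_smul_eq_zero v (k * (D * d) + D)
    (fun a => (totalDegree_mul _ _).trans <| add_le_add
      (totalDegree_prod_pow_le F d D hF _ fun l => Nat.lt_succ_iff.1 (a.2 l).2)
      (by rw [totalDegree_X_pow]; exact Nat.lt_succ_iff.1 a.1.2)) <| by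
    rw [← hk]
    calc (k * (D * d) + D + 1) ^ k ≤ ((k * d + 1) * (D + 1)) ^ k :=
          Nat.pow_le_pow_left (by nlinarith [Nat.zero_le (k * d)]) k
      _ = D * (D + 1) ^ k := by rw [mul_pow]
      _ < (D + 1) * (D + 1) ^ k := Nat.mul_lt_mul_of_pos_right (Nat.lt_succ_self D) (by positivity)
      _ = _ := by simp [hk]
  let p : Fin (D + 1) → MvPolynomial σ K := fun j =>
    ∑ α : σ → Fin (D + 1), monomial (Finsupp.equivFunOnFinite.symm fun l => (α l : ℕ)) (c (j, α))
  have hp_deg : ∀ j, (p j).totalDegree ≤ k * D := fun j =>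
    totalDegree_finsetSum_le fun α _ => (totalDegree_monomial_le _ _).trans <| by
      rw [Finsupp.sum_fintype _ _ fun _ => rfl]
      refine (Finset.sum_le_card_nsmul _ _ D fun l _ => ?_).trans (by simp [hk])
      simpa using Nat.lt_succ_iff.1 (α l).2
  have hp_coeff : ∀ j α, coeff (Finsupp.equivFunOnFinite.symm fun l => (α l : ℕ)) (p j)
      = c (j, α) := fun j α => by
    simp only [p, coeff_sum, coeff_monomial]
    rw [Finset.sum_eq_single α _ (by simp)]
    · simp
    · intro β _ hβ
      refine if_neg fun h => hβ (_root_.funext fun l => Fin.ext ?_)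
      simpa using DFunLike.congr_fun h l
  let P : Polynomial (MvPolynomial σ K) := ∑ j : Fin (D + 1), Polynomial.monomial (j : ℕ) (p j)
  have hP_coeff : ∀ j : Fin (D + 1), P.coeff j = p j := fun j => by
    simp only [P, Polynomial.finsetSum_coeff, Polynomial.coeff_monomial]
    simp [← Fin.ext_iff]
  have hP_deg : ∀ n, (P.coeff n).totalDegree ≤ k * D := fun n => by
    simp only [P, Polynomial.finsetSum_coeff, Polynomial.coeff_monomial]
    refine totalDegree_finsetSum_le fun j _ => ?_
    split_ifs
    · exact hp_deg j
    · simp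
  have hP0 : P ≠ 0 := fun h => hc0 <| by
    ext ⟨j, α⟩
    rw [← hp_coeff, ← hP_coeff, h]
    simp
  have hPG : P.eval (G i) = 0 := by
    -- Substituting `G` turns each `F l` into `X l` and `X i` into `G i`.
    have h := congrArg (bind₁ G) hc
    rw [map_zero, map_sum, Fintype.sum_prod_type] at h
    rw [← h, Polynomial.eval_finsetSum]
    refine Finset.sum_congr rfl fun j _ => ?_
    rw [Polynomial.eval_monomial, Finset.sum_mul]
    refine Finset.sum_congr rfl fun α _ => ?_
    simp only [v, map_smul, map_mul, map_prod, map_pow, hFG, bind₁_X_right]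
    rw [monomial_eq, Finsupp.prod_fintype _ _ (by simp), smul_eq_C_mul, mul_assoc]
    simp
  obtain ⟨n, hn, hdvd⟩ := Polynomial.exists_coeff_ne_zero_dvd hP0 hGi hPG
  exact (totalDegree_le_of_dvd_of_isDomain hdvd hn).trans (hP_deg n)

end MvPolynomial

/-! ### Degrees of polynomial automorphisms and their inverses. -/

namespace PolyAut

theorem bind₁_components {k : ℕ} (f : PolyAut k) (i : Fin k) :
    MvPolynomial.bind₁ (components f⁻¹) (components f i) = MvPolynomial.X i := by
  refine MvPolynomial.funext fun z => ?_
  have h : (fun j => MvPolynomial.eval z (components f⁻¹ j)) =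
      ((f⁻¹ : PolyAut k) : Equiv.Perm (Fin k → ℂ)) z := funext (eval_components f⁻¹ z)
  have h' : MvPolynomial.eval z (MvPolynomial.bind₁ (components f⁻¹) (components f i)) =
      MvPolynomial.eval (fun j => MvPolynomial.eval z (components f⁻¹ j)) (components f i) := by
    simp only [← MvPolynomial.coe_aeval_eq_eval, RingHom.coe_coe, MvPolynomial.aeval_bind₁]
  rw [h', h, eval_components, MvPolynomial.eval_X]
  simp

theorem totalDegree_components_le {k : ℕ} (f : PolyAut k) (i : Fin k) :
    (components f i).totalDegree ≤ deg f :=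
  Finset.le_sup (f := fun i => (components f i).totalDegree) (Finset.mem_univ i)

theorem deg_pos {k : ℕ} (hk : 1 ≤ k) (f : PolyAut k) : 1 ≤ deg f := by
  by_contra h
  have hconst : ∀ z, (f : Equiv.Perm (Fin k → ℂ)) z =
      fun i => MvPolynomial.coeff 0 (components f i) := fun z => funext fun i => by
    have h0 : (components f i).totalDegree = 0 := by
      have := totalDegree_components_le f i
      omega
    rw [← eval_components, MvPolynomial.totalDegree_eq_zero_iff_eq_C.1 h0]
    simp
  have := (f : Equiv.Perm (Fin k → ℂ)).injective ((hconst 0).trans (hconst 1).symm)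
  exact zero_ne_one (congrFun this ⟨0, hk⟩)

theorem deg_inv_le {k : ℕ} (f : PolyAut k) : deg f⁻¹ ≤ k * (k + 1) ^ k * deg f ^ k := by
  rcases Nat.eq_zero_or_pos k with rfl | hk
  · simp [deg]
  have hd := deg_pos hk f
  refine Finset.sup_le fun i _ => ?_
  have h := MvPolynomial.totalDegree_le_of_bind₁_eq_X (components f) (components f⁻¹)
    (bind₁_components f) (deg f) (totalDegree_components_le f) i
  rw [Fintype.card_fin] at h
  refine h.trans ?_
  rw [mul_assoc, ← mul_pow]
  exact Nat.mul_le_mul_left k (Nat.pow_le_pow_left (by nlinarith) k)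

/-- In one variable degrees multiply under composition, and the composite with the inverse has
degree one. -/
theorem deg_le_one (f : PolyAut 1) : deg f ≤ 1 := by
  let φ : MvPolynomial (Fin 1) ℂ →ₐ[ℂ] Polynomial ℂ := MvPolynomial.aeval fun _ => Polynomial.X
  let ψ : Polynomial ℂ →ₐ[ℂ] MvPolynomial (Fin 1) ℂ := Polynomial.aeval (MvPolynomial.X 0)
  have hψφ : ∀ p, ψ (φ p) = p := fun p => by
    have : ψ.comp φ = AlgHom.id ℂ _ := by
      ext j
      simp [φ, ψ, Subsingleton.elim j 0]
    exact DFunLike.congr_fun this p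
  have hcomp : (φ (components f 0)).comp (φ (components f⁻¹ 0)) = Polynomial.X := by
    have h := congrArg φ (bind₁_components f 0)
    have h' : φ (MvPolynomial.X 0) = Polynomial.X := by simp [φ]
    rw [h'] at h
    rw [← h]
    have : (Polynomial.compRingHom (φ (components f⁻¹ 0))).comp φ.toRingHom =
        (φ.comp (MvPolynomial.bind₁ (components f⁻¹))).toRingHom := by
      ext j
      · simp [φ]
      · simp [φ, Subsingleton.elim j 0]
    exact DFunLike.congr_fun this _
  have hdeg : (φ (components f 0)).natDegree ≤ 1 := by
    have h := congrArg Polynomial.natDegree hcomp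
    rw [Polynomial.natDegree_comp, Polynomial.natDegree_X] at h
    exact (Nat.eq_one_of_mul_eq_one_right h).le
  refine Finset.sup_le fun i _ => ?_
  rw [Subsingleton.elim i 0]
  obtain ⟨a, b, hab⟩ := Polynomial.exists_eq_X_add_C_of_natDegree_le_one hdeg
  rw [← hψφ (components f 0), hab]
  simp only [ψ, map_add, map_mul, Polynomial.aeval_C, Polynomial.aeval_X,
    MvPolynomial.algebraMap_eq]
  refine (MvPolynomial.totalDegree_add _ _).trans (max_le ?_ (by simp))
  exact (MvPolynomial.totalDegree_mul _ _).trans (by simp)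

end PolyAut

/-! ### Transfer of growth between sequences. -/

theorem bddAbove_range_of_le_mul_pow {u v : ℕ → ℕ} {A k : ℕ} (h : ∀ n, v n ≤ A * u n ^ k)
    (hu : BddAbove (Set.range u)) : BddAbove (Set.range v) := by
  obtain ⟨B, hB⟩ := hu
  refine ⟨A * B ^ k, ?_⟩
  rintro _ ⟨n, rfl⟩
  exact (h n).trans (Nat.mul_le_mul_left A (Nat.pow_le_pow_left (hB ⟨n, rfl⟩) k))

theorem GrowsExponentially.of_le_mul_pow {u v : ℕ → ℕ} {A k : ℕ} (hk : k ≠ 0) (hA : 0 < A)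
    (huv : ∀ n, u n ≤ A * v n ^ k) (hvu : ∀ n, v n ≤ A * u n ^ k)
    (hu : GrowsExponentially u) : GrowsExponentially v := by
  obtain ⟨a, b, c, C, ha, hb, hc, hC, h⟩ := hu
  have hA' : (0 : ℝ) < A := by exact_mod_cast hA
  have ha0 : 0 ≤ a := by linarith
  -- The lower bound is a `k`-th root taken in `huv`, the upper one a `k`-th power inserted in
  -- `hvu`.
  refine ⟨a ^ (k⁻¹ : ℝ), b ^ k, (c / A) ^ (k⁻¹ : ℝ), A * C ^ k,
    Real.one_lt_rpow ha (by positivity), one_lt_pow₀ hb hk, by positivity, by positivity, ?_⟩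
  filter_upwards [h] with n hn
  constructor
  · refine le_of_pow_le_pow_left₀ hk (Nat.cast_nonneg _) ?_
    rw [mul_pow, ← pow_mul, mul_comm n k, pow_mul, Real.rpow_inv_natCast_pow (by positivity) hk,
      Real.rpow_inv_natCast_pow ha0 hk, div_mul_eq_mul_div, div_le_iff₀ hA', mul_comm _ (A : ℝ)]
    exact hn.1.trans (by exact_mod_cast huv n)
  · calc (v n : ℝ) ≤ A * (u n : ℝ) ^ k := by exact_mod_cast hvu n
      _ ≤ A * (C * b ^ n) ^ k := by gcongr; exact hn.2
      _ = A * C ^ k * (b ^ k) ^ n := by rw [mul_pow, ← pow_mul, mul_comm n k, pow_mul, mul_assoc]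

theorem le_of_pow_isBigO_pow {p q : ℕ}
    (h : (fun n : ℕ => (n : ℝ) ^ p) =O[atTop] fun n : ℕ => (n : ℝ) ^ q) : p ≤ q := by
  by_contra! hqp
  have hlt := (isLittleO_pow_pow_atTop_of_lt (𝕜 := ℝ) hqp).comp_tendsto
    tendsto_natCast_atTop_atTop
  refine hlt.not_isBigO ?_ h
  refine (Eventually.frequently ?_)
  filter_upwards [eventually_gt_atTop 0] with n hn
  simp only [Function.comp_apply]
  positivity

theorem GrowsLikePow.le_mul_of_le_mul_pow {u v : ℕ → ℕ} {A k p q : ℕ}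
    (huv : ∀ n, u n ≤ A * v n ^ k) (hu : GrowsLikePow u p) (hv : GrowsLikePow v q) :
    p ≤ k * q := by
  refine le_of_pow_isBigO_pow (hu.2.trans ?_)
  have h1 : (fun n => (u n : ℝ)) =O[atTop] fun n => (v n : ℝ) ^ k :=
    IsBigO.of_bound A <| Eventually.of_forall fun n => by
      rw [Real.norm_of_nonneg (Nat.cast_nonneg _), Real.norm_of_nonneg (by positivity)]
      exact_mod_cast huv n
  refine h1.trans ?_
  simpa only [← pow_mul, mul_comm q k] using hv.1.pow k

theorem GrowsLikePow.eq_zero_of_le {u : ℕ → ℕ} {B p : ℕ} (h : ∀ n, u n ≤ B)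
    (hu : GrowsLikePow u p) : p = 0 := by
  have := GrowsLikePow.le_mul_of_le_mul_pow (A := B) (k := 0) (v := fun n => n ^ 0) (q := 0)
    (by simpa using h) hu (by simp [GrowsLikePow])
  omega

/-- In the last part `(q + 1) / k` is the quotient of natural numbers, that is, the integer part
of the fraction. -/
theorem mainTheorem6 (k : ℕ) (f : PolyAut k) :
    (BddAbove (Set.range fun n : ℕ => PolyAut.deg (f ^ n)) ↔
      BddAbove (Set.range fun n : ℕ => PolyAut.deg (f ^ (-(n : ℤ))))) ∧
    (GrowsExponentially (fun n : ℕ => PolyAut.deg (f ^ n)) ↔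
      GrowsExponentially (fun n : ℕ => PolyAut.deg (f ^ (-(n : ℤ))))) ∧
    (∀ p q : ℕ, 1 ≤ p → 1 ≤ q →
      GrowsLikePow (fun n : ℕ => PolyAut.deg (f ^ n)) p →
      GrowsLikePow (fun n : ℕ => PolyAut.deg (f ^ (-(n : ℤ)))) q →
      (q + 1) / k ≤ p ∧ p ≤ k * q) := by
  have hvu : ∀ n : ℕ, PolyAut.deg (f ^ (-(n : ℤ))) ≤
      k * (k + 1) ^ k * PolyAut.deg (f ^ n) ^ k := fun n => by
    rw [zpow_neg, zpow_natCast]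
    exact PolyAut.deg_inv_le _
  have huv : ∀ n : ℕ, PolyAut.deg (f ^ n) ≤
      k * (k + 1) ^ k * PolyAut.deg (f ^ (-(n : ℤ))) ^ k := fun n => by
    have h := PolyAut.deg_inv_le (f ^ (-(n : ℤ)))
    rwa [zpow_neg, inv_inv, ← zpow_neg, zpow_natCast] at h
  refine ⟨⟨bddAbove_range_of_le_mul_pow hvu, bddAbove_range_of_le_mul_pow huv⟩, ?_, ?_⟩
  · rcases Nat.eq_zero_or_pos k with rfl | hk
    -- For `k = 0` the supremum is empty and every degree is `0`.
    · simp [PolyAut.deg]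
    · have hA : 0 < k * (k + 1) ^ k := by positivity
      exact ⟨.of_le_mul_pow hk.ne' hA huv hvu, .of_le_mul_pow hk.ne' hA hvu huv⟩
  · intro p q hp hq hu hv
    have hpq := GrowsLikePow.le_mul_of_le_mul_pow huv hu hv
    have hqp := GrowsLikePow.le_mul_of_le_mul_pow hvu hv hu
    refine ⟨?_, hpq⟩
    -- The floor bound amounts to `q + 1 < (p + 1) * k`, which follows from `q ≤ k * p` once `k ≥
    -- 2`. For `k ≤ 1` the hypothesis `1 ≤ p` fails.
    have hk : 2 ≤ k := by
      by_contra! hk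
      interval_cases k
      · omega
      · exact Nat.one_le_iff_ne_zero.1 hp (hu.eq_zero_of_le fun n => PolyAut.deg_le_one _)
    refine Nat.lt_succ_iff.1 ((Nat.div_lt_iff_lt_mul (by omega)).2 ?_)
    nlinarith
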